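/- Let $\mathcal B$ and $\mathcal C$ be $C^*$-algebras with $\mathcal B$ unital, let $E$ be a (right) Hilbert $\mathcal B$-module and $F$ a (right) Hilbert $\mathcal C$-module, let $S$ be a set, and for each $\sigma\in S$ let $\mathcal K^\sigma:E\to F$ be a map. Then the following conditions are equivalent: (i) There is a map $\mathfrak K:S\times S\to\mathcal B(\mathcal B,\mathcal C)$ into the bounded linear maps from $\mathcal B$ to $\mathcal C$ which is a completely positive definite kernel, i.e. $\sum_{i,j}c_i^*\,\mathfrak K^{\sigma_i,\sigma_j}(b_i^*b_j)\,c_j\ge 0$ for all finite choices of $\sigma_i\in S$, $b_i\in\mathcal B$, $c_i\in\mathcal C$, such that $\{\mathcal K^\sigma\}_{\sigma\in S}$ is a $\mathfrak K$-family, i.e. $\langle\mathcal K^\sigma(x),\mathcal K^{\sigma'}(x')\rangle=\mathfrak K^{\sigma,\sigma'}(\langle x,x'\rangle)$ for all $x,x'\in E$ and $\sigma,\sigma'\in S$. (ii) There exist a $C^*$-correspondence $\mathcal F$ from $\mathcal B$ to $\mathcal C$ (a Hilbert $\mathcal C$-module with a $*$-homomorphism from $\mathcal B$ to its adjointable operators),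 a map $\mathfrak i:S\to\mathcal F$, and an isometry $\nu:E\odot\mathcal F\to F$ (a linear map preserving the $\mathcal C$-valued inner product) such that $\nu(x\odot\mathfrak i(\sigma))=\mathcal K^\sigma(x)$ for all $x\in E$, $\sigma\in S$. Here $E\odot\mathcal F$ is the interior tensor product: the Hilbert $\mathcal C$-module obtained from the algebraic tensor product by dividing out the vectors of length zero for the semi-inner product $\langle x\otimes y,x'\otimes y'\rangle=\langle y,\langle x,x'\rangle y'\rangle$ and completing. -/

import Mathlib

open scoped ComplexConjugate TensorProduct
open MulOpposite (op)

/-! ### Right inner-product modules over a C⋆-algebra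

Throughout, a right action `x b` of `b : B` on `x : E` is Mathlib's `op b • x`.
(Mathlib's `CStarModule` is a *left* module with `⟪x, a • y⟫ = a * ⟪x, y⟫`, hence it is not the
notion of right Hilbert module used here.) -/

/-- A complex vector space which is a right `B`-module (with compatible scalar multiplications),
equipped with a `B`-valued semi-inner product: all axioms of an inner-product `B`-module, except
that `⟪x, x⟫ = 0` need not imply `x = 0`. -/
class SemiInnerProductModule (B : Type*) (E : Type*) [NonUnitalCStarAlgebra B] [PartialOrder B]
    [StarOrderedRing B] [AddCommGroup E] [Module ℂ E] extends SMul Bᵐᵒᵖ E, Inner B E where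
  op_smul_add (b : B) (x y : E) : op b • (x + y) = op b • x + op b • y
  add_op_smul (b b' : B) (x : E) : op (b + b') • x = op b • x + op b' • x
  mul_op_smul (b b' : B) (x : E) : op (b * b') • x = op b' • (op b • x)
  op_smul_smul (b : B) (α : ℂ) (x : E) : op b • (α • x) = α • (op b • x)
  smul_op_smul (b : B) (α : ℂ) (x : E) : op (α • b) • x = α • (op b • x)
  inner_add_right (x y z : E) : inner x (y + z) = inner x y + inner x z
  inner_smul_right (α : ℂ) (x y : E) : inner x (α • y) = α • inner x y
  inner_op_smul_right (b : B) (x y : E) : inner x (op b • y) = inner x y * b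
  star_inner (x y : E) : star (inner x y) = inner y x
  inner_self_nonneg (x : E) : 0 ≤ inner x x

/-- A Hilbert `B`-module: a right inner-product `B`-module which is complete with respect to the
norm `‖x‖ = ‖⟪x, x⟫‖ ^ (1/2)`. -/
class HilbertModule (B : Type*) (E : Type*) [NonUnitalCStarAlgebra B] [PartialOrder B]
    [StarOrderedRing B] [NormedAddCommGroup E] [NormedSpace ℂ E]
    extends SemiInnerProductModule B E, CompleteSpace E where
  eq_zero_of_inner_self (x : E) : inner x x = 0 → x = 0
  norm_eq (x : E) : ‖x‖ = √‖inner x x‖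

namespace SemiInnerProductModule

section basic

variable {B E : Type*} [NonUnitalCStarAlgebra B] [PartialOrder B] [StarOrderedRing B]
  [AddCommGroup E] [Module ℂ E] [SemiInnerProductModule B E]

theorem inner_add_left (x y z : E) : inner B (x + y) z = inner B x z + inner B y z := by
  rw [← star_inner z (x + y), inner_add_right, star_add, star_inner, star_inner]

theorem inner_smul_left (α : ℂ) (x y : E) : inner B (α • x) y = star α • inner B x y := by
  rw [← star_inner y (α • x), inner_smul_right, star_smul, star_inner]

theorem inner_op_smul_left (b : B) (x y : E) : inner B (op b • x) y = star b * inner B x y := by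
  rw [← star_inner y (op b • x), inner_op_smul_right, star_mul, star_inner]

variable (B E) in
/-- The semi-inner product as a sesquilinear map. -/
def innerₛₗ : E →ₗ⋆[ℂ] E →ₗ[ℂ] B where
  toFun x :=
    { toFun := fun y => inner B x y
      map_add' := inner_add_right x
      map_smul' := fun α y => inner_smul_right α x y }
  map_add' x y := by ext z; exact inner_add_left x y z
  map_smul' α x := by ext z; exact inner_smul_left α x z

theorem innerₛₗ_apply (x y : E) : innerₛₗ B E x y = inner B x y := rfl

theorem inner_zero_right (x : E) : inner B x (0 : E) = 0 := map_zero (innerₛₗ B E x)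

theorem inner_zero_left (x : E) : inner B (0 : E) x = 0 := by
  simp [← innerₛₗ_apply]

theorem inner_sub_right (x y z : E) : inner B x (y - z) = inner B x y - inner B x z :=
  map_sub (innerₛₗ B E x) y z

theorem inner_sub_left (x y z : E) : inner B (x - y) z = inner B x z - inner B y z := by
  simp [← innerₛₗ_apply]

theorem inner_sum_right {ι : Type*} (s : Finset ι) (x : E) (y : ι → E) :
    inner B x (∑ i ∈ s, y i) = ∑ i ∈ s, inner B x (y i) :=
  map_sum (innerₛₗ B E x) _ _

theorem inner_sum_left {ι : Type*} (s : Finset ι) (x : ι → E) (y : E) :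
    inner B (∑ i ∈ s, x i) y = ∑ i ∈ s, inner B (x i) y := by
  simp [← innerₛₗ_apply]

variable (B E) in
/-- The right action of `b` as a linear map. -/
def rightMul (b : B) : E →ₗ[ℂ] E where
  toFun x := op b • x
  map_add' := op_smul_add b
  map_smul' α x := op_smul_smul b α x

theorem rightMul_apply (b : B) (x : E) : rightMul B E b x = op b • x := rfl

/-- The Cauchy–Schwarz inequality for semi-inner products. -/
theorem norm_inner_sq_le (x y : E) :
    ‖inner B x y‖ ^ 2 ≤ ‖inner B x x‖ * ‖inner B y y‖ := by
  have key : ∀ ε : ℝ, 0 < ε → ‖inner B x y‖ ^ 2 ≤ (‖inner B x x‖ + ε) * ‖inner B y y‖ := by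
    intro ε hε
    set t : ℝ := ‖inner B x x‖ + ε with ht
    have htpos : 0 < t := by positivity
    set a : B := inner B x y with ha
    have h1 : 0 ≤ inner B (op a • x - (t : ℂ) • y) (op a • x - (t : ℂ) • y) :=
      inner_self_nonneg _
    have h2 : inner B (op a • x - (t : ℂ) • y) (op a • x - (t : ℂ) • y)
        = star a * inner B x x * a - (2 * t) • (star a * a) + (t * t) • inner B y y := by
      simp only [inner_sub_right, inner_sub_left, inner_op_smul_right, inner_op_smul_left,
        inner_smul_left, inner_smul_right, ← ha, ← star_inner x y]
      simp only [Complex.star_def, Complex.conj_ofReal, Complex.coe_smul, sub_mul,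
        smul_mul_assoc]
      module
    have h3 : star a * inner B x x * a ≤ t • (star a * a) := by
      refine (CStarAlgebra.star_left_conjugate_le_norm_smul
        (IsSelfAdjoint.of_nonneg (inner_self_nonneg x))).trans ?_
      rw [ht, add_smul]
      exact le_add_of_nonneg_right (smul_nonneg hε.le (star_mul_self_nonneg a))
    have h4 : t • (star a * a) ≤ t • (t • inner B y y) := by
      rw [h2] at h1
      have h5 : (0 : B) ≤ t • (star a * a) - (2 * t) • (star a * a) + (t * t) • inner B y y :=
        h1.trans (by gcongr)
      have h6 : t • (star a * a) - (2 * t) • (star a * a) + (t * t) • inner B y y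
          = t • (t • inner B y y) - t • (star a * a) := by
        module
      rw [h6] at h5
      exact sub_nonneg.mp h5
    have h7 : star a * a ≤ t • inner B y y := (smul_le_smul_iff_of_pos_left htpos).mp h4
    have h8 := CStarAlgebra.norm_le_norm_of_nonneg_of_le (star_mul_self_nonneg a) h7
    rwa [CStarRing.norm_star_mul_self, norm_smul, Real.norm_of_nonneg htpos.le, ← sq] at h8
  by_cases hy : ‖inner B y y‖ = 0
  · simpa [hy] using key 1 one_pos
  · have hy' : 0 < ‖inner B y y‖ := lt_of_le_of_ne (norm_nonneg _) (Ne.symm hy)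
    refine le_of_forall_pos_le_add fun ε hε => ?_
    have := key (ε / ‖inner B y y‖) (by positivity)
    rwa [add_mul, div_mul_cancel₀ _ hy] at this

end basic

/-! ### Hausdorff completion of a semi-inner-product module -/

/-- A copy of `E`, carrying the seminorm `‖x‖ = ‖⟪x, x⟫‖ ^ (1/2)`. -/
def Seminormed (_B : Type*) (E : Type*) : Type _ := E

section completion

variable (B E : Type*) [NonUnitalCStarAlgebra B] [PartialOrder B] [StarOrderedRing B]
  [AddCommGroup E] [Module ℂ E] [SemiInnerProductModule B E]

/-- The seminorm axioms for `‖⟪x, x⟫‖ ^ (1/2)`. -/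
theorem seminormCore :
    letI : Norm E := ⟨fun x => √‖inner B x x‖⟩
    SeminormedSpace.Core ℂ E := by
  let _ : Norm E := ⟨fun x => √‖inner B x x‖⟩
  have hn : ∀ x : E, ‖x‖ = √‖inner B x x‖ := fun _ => rfl
  refine ⟨fun x => Real.sqrt_nonneg _, fun α x => ?_, fun x y => ?_⟩
  · rw [hn, hn, inner_smul_left, inner_smul_right, norm_smul, norm_smul, norm_star, ← mul_assoc,
      Real.sqrt_mul (by positivity), Real.sqrt_mul_self (norm_nonneg _)]
  · have hxy : ∀ x y : E, ‖inner B x y‖ ≤ √‖inner B x x‖ * √‖inner B y y‖ := fun x y => by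
      rw [← Real.sqrt_mul (norm_nonneg _)]
      exact Real.le_sqrt_of_sq_le (norm_inner_sq_le x y)
    rw [hn, hn, hn]
    refine Real.sqrt_le_iff.mpr ⟨by positivity, ?_⟩
    rw [inner_add_left, inner_add_right, inner_add_right]
    have h1 := norm_add_le (inner B x x + inner B x y) (inner B y x + inner B y y)
    have h2 := norm_add_le (inner B x x) (inner B x y)
    have h3 := norm_add_le (inner B y x) (inner B y y)
    have hx := Real.sq_sqrt (norm_nonneg (inner B x x))
    have hy := Real.sq_sqrt (norm_nonneg (inner B y y))
    nlinarith [hxy x y, hxy y x]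

noncomputable instance : SeminormedAddCommGroup (Seminormed B E) :=
  letI : Norm E := ⟨fun x => √‖inner B x x‖⟩
  SeminormedAddCommGroup.ofCore (𝕜 := ℂ) (E := E) (seminormCore B E)

noncomputable instance : NormedSpace ℂ (Seminormed B E) where
  toModule := inferInstanceAs (Module ℂ E)
  norm_smul_le α x := by
    let _ : Norm E := ⟨fun x => √‖inner B x x‖⟩
    exact ((seminormCore B E).norm_smul α x).le

instance : SemiInnerProductModule B (Seminormed B E) :=
  inferInstanceAs (SemiInnerProductModule B E)

/-- The Hausdorff completion of `E` with respect to the seminorm `‖⟪x, x⟫‖ ^ (1/2)`: vectors of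
length zero are divided out and the quotient is completed. -/
def Completion : Type _ := UniformSpace.Completion (Seminormed B E)

noncomputable instance : NormedAddCommGroup (Completion B E) :=
  inferInstanceAs (NormedAddCommGroup (UniformSpace.Completion (Seminormed B E)))

noncomputable instance : NormedSpace ℂ (Completion B E) :=
  inferInstanceAs (NormedSpace ℂ (UniformSpace.Completion (Seminormed B E)))

/-- The canonical linear map from `E` to its completion. -/
noncomputable def toCompletion : E →ₗ[ℂ] Completion B E :=
  (UniformSpace.Completion.toComplₗᵢ : Seminormed B E →ₗᵢ[ℂ] _).toLinearMap


theorem norm_seminormed (x : Seminormed B E) : ‖x‖ = √‖inner B x x‖ := rfl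

theorem continuous_inner_seminormed :
    Continuous fun p : Seminormed B E × Seminormed B E => inner B p.1 p.2 := by
  have hb : ∀ x y : Seminormed B E, ‖innerₛₗ B (Seminormed B E) x y‖ ≤ 1 * ‖x‖ * ‖y‖ := by
    intro x y
    rw [one_mul, norm_seminormed, norm_seminormed, ← Real.sqrt_mul (norm_nonneg _)]
    exact Real.le_sqrt_of_sq_le (norm_inner_sq_le x y)
  have h := (LinearMap.mkContinuous₂ (innerₛₗ B (Seminormed B E)) 1 hb)
  have h' : Continuous fun p : Seminormed B E × Seminormed B E =>
      (LinearMap.mkContinuous₂ (innerₛₗ B (Seminormed B E)) 1 hb) p.1 p.2 := by fun_prop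
  exact h'

instance : UniformContinuousConstSMul Bᵐᵒᵖ (Seminormed B E) := by
  refine ⟨fun c => ?_⟩
  obtain ⟨b, rfl⟩ := MulOpposite.op_surjective c
  have hb : ∀ x : Seminormed B E, ‖rightMul B (Seminormed B E) b x‖ ≤ ‖b‖ * ‖x‖ := by
    intro x
    rw [rightMul_apply, norm_seminormed, norm_seminormed, inner_op_smul_right,
      inner_op_smul_left]
    refine Real.sqrt_le_iff.mpr ⟨by positivity, ?_⟩
    rw [mul_pow, Real.sq_sqrt (norm_nonneg _)]
    calc ‖star b * inner B x x * b‖ ≤ ‖star b‖ * ‖inner B x x‖ * ‖b‖ :=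
          (norm_mul_le _ _).trans (by gcongr; exact norm_mul_le _ _)
      _ = ‖b‖ ^ 2 * ‖inner B x x‖ := by rw [norm_star]; ring
  exact ((rightMul B (Seminormed B E) b).mkContinuous ‖b‖ hb).uniformContinuous

/-- The right action on the completion is the continuous extension of the right action. -/
noncomputable instance : SMul Bᵐᵒᵖ (Completion B E) :=
  inferInstanceAs (SMul Bᵐᵒᵖ (UniformSpace.Completion (Seminormed B E)))

/-- The inner product on the completion is the continuous extension of the semi-inner product. -/
noncomputable instance : Inner B (Completion B E) :=
  inferInstanceAs (Inner B (UniformSpace.Completion (Seminormed B E)))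

variable {E}

theorem toCompletion_op_smul (b : B) (x : E) :
    toCompletion B E (op b • x) = op b • toCompletion B E x :=
  UniformSpace.Completion.coe_smul (X := Seminormed B E) (op b) x

theorem inner_toCompletion (x y : E) :
    inner B (toCompletion B E x) (toCompletion B E y) = inner B x y :=
  ((UniformSpace.Completion.isDenseInducing_coe (α := Seminormed B E)).prodMap
    (UniformSpace.Completion.isDenseInducing_coe (α := Seminormed B E))).extend_eq
      (continuous_inner_seminormed B E) (x, y)

theorem norm_toCompletion (x : E) : ‖toCompletion B E x‖ = √‖inner B x x‖ :=
  UniformSpace.Completion.norm_coe (E := Seminormed B E) x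

variable (E)

theorem denseRange_toCompletion : DenseRange (toCompletion B E) :=
  UniformSpace.Completion.denseRange_coe (α := Seminormed B E)

theorem continuous_inner_completion :
    Continuous fun p : Completion B E × Completion B E => inner B p.1 p.2 := by
  let f : Seminormed B E →+ Seminormed B E →+ B :=
    { toFun := fun x => (innerₛₗ B (Seminormed B E) x).toAddMonoidHom
      map_zero' := by ext x; exact inner_zero_left (B := B) x
      map_add' := fun x y => by ext z; exact inner_add_left x y z }
  have : Continuous fun p : Seminormed B E × Seminormed B E => f p.1 p.2 :=
    continuous_inner_seminormed B E
  exact (UniformSpace.Completion.isDenseInducing_toCompl (Seminormed B E)).extend_Z_bilin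
    (UniformSpace.Completion.isDenseInducing_toCompl (Seminormed B E)) this

instance : ContinuousConstSMul Bᵐᵒᵖ (Completion B E) :=
  inferInstanceAs (ContinuousConstSMul Bᵐᵒᵖ (UniformSpace.Completion (Seminormed B E)))

instance : CompleteSpace (Completion B E) :=
  inferInstanceAs (CompleteSpace (UniformSpace.Completion (Seminormed B E)))

variable {E} in
/-- A closed condition on the completion holds if it holds on the image of `E`. -/
theorem completion_induction {p : Completion B E → Prop} (hp : IsClosed {x | p x})
    (h : ∀ x : E, p (toCompletion B E x)) (x : Completion B E) : p x :=
  (denseRange_toCompletion B E).induction_on x hp h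

/-- The Hausdorff completion of a semi-inner-product module is a Hilbert module. -/
noncomputable instance : HilbertModule B (Completion B E) :=
  have hi : Continuous fun p : Completion B E × Completion B E => inner B p.1 p.2 :=
    continuous_inner_completion B E
  have hr : ∀ x : Completion B E, Continuous fun y => inner B x y := fun x =>
    hi.comp (Continuous.prodMk_right x)
  have hl : ∀ y : Completion B E, Continuous fun x => inner B x y := fun y =>
    hi.comp (Continuous.prodMk_left y)
  have hd : Continuous fun x : Completion B E => inner B x x :=
    hi.comp (continuous_id.prodMk continuous_id)
  have hc : ∀ b : B, Continuous fun x : Completion B E => op b • x := fun b =>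
    continuous_const_smul (op b)
  have norm_eq : ∀ x : Completion B E, ‖x‖ = √‖inner B x x‖ := fun x => by
    induction x using completion_induction B with
    | hp => exact isClosed_eq continuous_norm (Real.continuous_sqrt.comp hd.norm)
    | h x => rw [norm_toCompletion, inner_toCompletion]
  { op_smul_add := fun b x y => by
      induction x using completion_induction B with
      | hp => exact isClosed_eq ((hc b).comp (continuous_add_const y)) ((hc b).add continuous_const)
      | h x =>
      induction y using completion_induction B with
      | hp => exact isClosed_eq ((hc b).comp (continuous_const_add _)) (continuous_const.add (hc b))
      | h y => simp only [← map_add, ← toCompletion_op_smul, op_smul_add]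
    add_op_smul := fun b b' x => by
      induction x using completion_induction B with
      | hp => exact isClosed_eq (hc _) ((hc b).add (hc b'))
      | h x => simp only [← map_add, ← toCompletion_op_smul, add_op_smul]
    mul_op_smul := fun b b' x => by
      induction x using completion_induction B with
      | hp => exact isClosed_eq (hc _) ((hc b').comp (hc b))
      | h x => simp only [← toCompletion_op_smul, mul_op_smul]
    op_smul_smul := fun b α x => by
      induction x using completion_induction B with
      | hp => exact isClosed_eq ((hc b).comp (continuous_const_smul α)) ((hc b).const_smul α)
      | h x => simp only [← map_smul, ← toCompletion_op_smul, op_smul_smul]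
    smul_op_smul := fun b α x => by
      induction x using completion_induction B with
      | hp => exact isClosed_eq (hc _) ((hc b).const_smul α)
      | h x => simp only [← map_smul, ← toCompletion_op_smul, smul_op_smul]
    inner_add_right := fun x y z => by
      induction x using completion_induction B with
      | hp => exact isClosed_eq (hl _) ((hl _).add (hl _))
      | h x =>
      induction y using completion_induction B with
      | hp => exact isClosed_eq ((hr _).comp (continuous_add_const z)) ((hr _).add continuous_const)
      | h y =>
      induction z using completion_induction B with
      | hp => exact isClosed_eq ((hr _).comp (continuous_const_add _)) (continuous_const.add (hr _))
      | h z => simp only [← map_add, inner_toCompletion, inner_add_right]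
    inner_smul_right := fun α x y => by
      induction x using completion_induction B with
      | hp => exact isClosed_eq (hl _) ((hl _).const_smul α)
      | h x =>
      induction y using completion_induction B with
      | hp => exact isClosed_eq ((hr _).comp (continuous_const_smul α)) ((hr _).const_smul α)
      | h y => simp only [← map_smul, inner_toCompletion, inner_smul_right]
    inner_op_smul_right := fun b x y => by
      induction x using completion_induction B with
      | hp => exact isClosed_eq (hl _) ((hl _).mul continuous_const)
      | h x =>
      induction y using completion_induction B with
      | hp => exact isClosed_eq ((hr _).comp (hc b)) ((hr _).mul continuous_const)
      | h y => simp only [← toCompletion_op_smul, inner_toCompletion, inner_op_smul_right]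
    star_inner := fun x y => by
      induction x using completion_induction B with
      | hp => exact isClosed_eq (hl _).star (hr _)
      | h x =>
      induction y using completion_induction B with
      | hp => exact isClosed_eq (hr _).star (hl _)
      | h y => simp only [inner_toCompletion, star_inner]
    inner_self_nonneg := fun x => by
      induction x using completion_induction B with
      | hp => exact isClosed_le continuous_const hd
      | h x => simp only [inner_toCompletion, inner_self_nonneg]
    eq_zero_of_inner_self := fun x hx => by
      rw [← norm_eq_zero, norm_eq, hx, norm_zero, Real.sqrt_zero]
    norm_eq := norm_eq }

end completion

end SemiInnerProductModule

/-! ### Adjointable maps, C⋆-correspondences, isometries -/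

/-- `T'` is an adjoint of the map `T` between Hilbert `C`-modules: `⟪T x, y⟫ = ⟪x, T' y⟫`. -/
def IsAdjointPair (C : Type*) {E F : Type*} [NonUnitalCStarAlgebra C] [PartialOrder C]
    [StarOrderedRing C] [NormedAddCommGroup E] [NormedSpace ℂ E] [HilbertModule C E]
    [NormedAddCommGroup F] [NormedSpace ℂ F] [HilbertModule C F] (T : E → F) (T' : F → E) : Prop :=
  ∀ x y, inner C (T x) y = inner C x (T' y)

/-- A C⋆-correspondence from `B` to `C`: a right Hilbert `C`-module `F` with a `⋆`-homomorphism from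
`B` to the adjointable operators on `F`, that is, an algebra homomorphism `φ` into the operators on
`F` such that each `φ b` has the adjoint `φ b⋆`. It need not preserve a unit. -/
class CStarCorrespondence (B C F : Type*) [NonUnitalCStarAlgebra B] [NonUnitalCStarAlgebra C]
    [PartialOrder C] [StarOrderedRing C] [NormedAddCommGroup F] [NormedSpace ℂ F]
    [HilbertModule C F] where
  leftAction : B →ₙₐ[ℂ] Module.End ℂ F
  isAdjointPair_leftAction (b : B) : IsAdjointPair C (leftAction b) (leftAction (star b))

/-- The left action commutes with the right action. -/
theorem CStarCorrespondence.leftAction_op_smul {B C F : Type*} [NonUnitalCStarAlgebra B]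
    [NonUnitalCStarAlgebra C] [PartialOrder C] [StarOrderedRing C] [NormedAddCommGroup F]
    [NormedSpace ℂ F] [HilbertModule C F] [CStarCorrespondence B C F] (b : B) (c : C) (y : F) :
    leftAction (C := C) b (op c • y) = op c • leftAction (C := C) b y := by
  rw [← sub_eq_zero]
  refine HilbertModule.eq_zero_of_inner_self (B := C) _ ?_
  have h : ∀ z : F, inner C z (leftAction (C := C) b (op c • y))
      = inner C z (op c • leftAction (C := C) b y) := by
    intro z
    rw [SemiInnerProductModule.inner_op_smul_right, ← star_star b,
      ← isAdjointPair_leftAction (star b), ← isAdjointPair_leftAction (star b),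
      SemiInnerProductModule.inner_op_smul_right]
  rw [SemiInnerProductModule.inner_sub_right, h, sub_self]

/-- A linear map between Hilbert `C`-modules is an isometry if it preserves the inner product. -/
def IsHilbertModuleIsometry (C : Type*) {E F : Type*} [NonUnitalCStarAlgebra C] [PartialOrder C]
    [StarOrderedRing C] [NormedAddCommGroup E] [NormedSpace ℂ E] [HilbertModule C E]
    [NormedAddCommGroup F] [NormedSpace ℂ F] [HilbertModule C F] (ν : E →ₗ[ℂ] F) : Prop :=
  ∀ u v, inner C (ν u) (ν v) = inner C u v

/-! ### The interior tensor product -/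

/-- A self-adjoint element is the difference of two orthogonal positive elements. -/
theorem SemiInnerProductModule.exists_posPart_negPart {A : Type*} [NonUnitalCStarAlgebra A]
    [PartialOrder A] [StarOrderedRing A] (a : A) (ha : IsSelfAdjoint a) :
    ∃ p n : A, 0 ≤ p ∧ 0 ≤ n ∧ n * p = 0 ∧ a = p - n :=
  ⟨a⁺, a⁻, CFC.posPart_nonneg a, CFC.negPart_nonneg a, CFC.negPart_mul_posPart a,
    (CFC.posPart_sub_negPart a ha).symm⟩

theorem SemiInnerProductModule.exists_eq_star_mul_self {A : Type*} [NonUnitalCStarAlgebra A]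
    [PartialOrder A] [StarOrderedRing A] (a : A) (ha : 0 ≤ a) : ∃ d : A, a = star d * d :=
  CStarAlgebra.nonneg_iff_eq_star_mul_self.mp ha

/-- Gram matrices in a semi-inner-product module are of the form `D⋆ D`. -/
theorem SemiInnerProductModule.exists_gram {B E : Type*} [NonUnitalCStarAlgebra B] [PartialOrder B]
    [StarOrderedRing B] [AddCommGroup E] [Module ℂ E] [SemiInnerProductModule B E]
    {ι : Type*} [Fintype ι] (x : ι → E) :
    ∃ D : ι → ι → B, ∀ i j, inner B (x i) (x j) = ∑ k, star (D k i) * D k j := by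
  classical
  let A : CStarMatrix ι ι B := CStarMatrix.ofMatrix fun i j => inner B (x i) (x j)
  have hA : ∀ i j, A i j = inner B (x i) (x j) := fun _ _ => rfl
  have hsa : IsSelfAdjoint A := by
    ext i j
    rw [CStarMatrix.star_apply, hA, hA, star_inner]
  have hM : ∀ (M : CStarMatrix ι ι B) (k : ι), 0 ≤ (star M * A * M) k k := by
    intro M k
    have : (star M * A * M) k k
        = inner B (∑ i, op (M i k) • x i) (∑ j, op (M j k) • x j) := by
      simp only [CStarMatrix.mul_apply, CStarMatrix.star_apply, hA, inner_sum_right,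
        inner_sum_left, inner_op_smul_left, inner_op_smul_right, Finset.sum_mul]
    rw [this]
    exact inner_self_nonneg _
  obtain ⟨p, n, hp, hneg, h0, hpn⟩ := exists_posPart_negPart A hsa
  have hnsa : star n = n := (IsSelfAdjoint.of_nonneg hneg).star_eq
  have hmul : n * A * n = -(n * n * n) := by
    rw [hpn, mul_sub, h0, zero_sub, neg_mul]
  have hcube : 0 ≤ n * n * n := by
    have := star_left_conjugate_nonneg hneg n
    rwa [hnsa] at this
  obtain ⟨D, hD⟩ := exists_eq_star_mul_self _ hcube
  have hD0 : D = 0 := by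
    ext k i
    have h1 := hM n i
    rw [hnsa, hmul, hD, CStarMatrix.neg_apply, CStarMatrix.mul_apply, neg_nonneg] at h1
    simp only [CStarMatrix.star_apply] at h1
    have h2 : ∑ j, star (D j i) * D j i = 0 :=
      le_antisymm h1 (Finset.sum_nonneg fun j _ => star_mul_self_nonneg _)
    have h3 := (Finset.sum_eq_zero_iff_of_nonneg
      (fun j _ => star_mul_self_nonneg (D j i))).mp h2 k (Finset.mem_univ k)
    exact CStarRing.star_mul_self_eq_zero_iff _ |>.mp h3
  have hzero : n = 0 := by
    have h3 : n * n * n = 0 := by rw [hD, hD0, mul_zero]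
    have h4 : star (n * n) * (n * n) = 0 := by
      rw [star_mul, hnsa, ← mul_assoc, h3, zero_mul]
    have h5 : star n * n = 0 := by
      rw [hnsa]; exact CStarRing.star_mul_self_eq_zero_iff _ |>.mp h4
    exact CStarRing.star_mul_self_eq_zero_iff _ |>.mp h5
  have hpos : 0 ≤ A := by
    rw [hpn, hzero, sub_zero]
    exact hp
  obtain ⟨D, hD⟩ := exists_eq_star_mul_self _ hpos
  refine ⟨D, fun i j => ?_⟩
  rw [← hA, hD, CStarMatrix.mul_apply]
  simp only [CStarMatrix.star_apply]

namespace InteriorTensor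

open SemiInnerProductModule CStarCorrespondence

variable (B C E F : Type*) [NonUnitalCStarAlgebra B] [PartialOrder B] [StarOrderedRing B]
  [NonUnitalCStarAlgebra C] [PartialOrder C] [StarOrderedRing C]
  [NormedAddCommGroup E] [NormedSpace ℂ E] [HilbertModule B E]
  [NormedAddCommGroup F] [NormedSpace ℂ F] [HilbertModule C F] [CStarCorrespondence B C F]

/-- A copy of the algebraic tensor product `E ⊗ F` over `ℂ`, carrying the `C`-valued semi-inner
product `⟪x ⊗ y, x' ⊗ y'⟫ = ⟪y, ⟪x, x'⟫ y'⟫` and the right action `(x ⊗ y) c = x ⊗ (y c)`. -/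
def Algebraic (_B _C E F : Type*) [AddCommGroup E] [Module ℂ E] [AddCommGroup F] [Module ℂ F] :
    Type _ := E ⊗[ℂ] F

instance : AddCommGroup (Algebraic B C E F) := inferInstanceAs (AddCommGroup (E ⊗[ℂ] F))

instance : Module ℂ (Algebraic B C E F) := inferInstanceAs (Module ℂ (E ⊗[ℂ] F))

/-- For fixed `x, y`, the linear map on `E ⊗ F` given by `x' ⊗ y' ↦ ⟪y, ⟪x, x'⟫ y'⟫`. -/
noncomputable def innerAux (x : E) (y : F) : E ⊗[ℂ] F →ₗ[ℂ] C :=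
  TensorProduct.lift (LinearMap.mk₂ ℂ
    (fun (x' : E) (y' : F) => inner C y (leftAction (C := C) (inner B x x' : B) y'))
    (fun x₁ x₂ y' => by
      simp only [SemiInnerProductModule.inner_add_right, map_add, LinearMap.add_apply])
    (fun α x' y' => by
      simp only [SemiInnerProductModule.inner_smul_right, map_smul, LinearMap.smul_apply])
    (fun x' y₁ y₂ => by simp only [SemiInnerProductModule.inner_add_right, map_add])
    (fun α x' y' => by simp only [SemiInnerProductModule.inner_smul_right, map_smul]))

/-- The semi-inner product on `E ⊗ F` as a sesquilinear map. -/
noncomputable def innerSesq : E ⊗[ℂ] F →ₗ⋆[ℂ] E ⊗[ℂ] F →ₗ[ℂ] C :=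
  TensorProduct.lift (LinearMap.mk₂'ₛₗ (starRingEnd ℂ) (starRingEnd ℂ) (innerAux B C E F)
    (fun x₁ x₂ y => by
      ext x' y'
      simp [innerAux, SemiInnerProductModule.inner_add_left,
        SemiInnerProductModule.inner_add_right])
    (fun α x y => by
      ext x' y'
      simp [innerAux, SemiInnerProductModule.inner_smul_left,
        SemiInnerProductModule.inner_smul_right])
    (fun x y₁ y₂ => by
      ext x' y'
      simp [innerAux, SemiInnerProductModule.inner_add_left])
    (fun α x y => by
      ext x' y'
      simp [innerAux, SemiInnerProductModule.inner_smul_left]))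

theorem innerSesq_tmul (x x' : E) (y y' : F) :
    innerSesq B C E F (x ⊗ₜ y) (x' ⊗ₜ y')
      = inner C y (leftAction (C := C) (inner B x x' : B) y') := rfl

theorem star_innerSesq (u v : E ⊗[ℂ] F) :
    star (innerSesq B C E F u v) = innerSesq B C E F v u := by
  induction u with
  | zero => simp
  | add u₁ u₂ h₁ h₂ => simp [h₁, h₂]
  | tmul x y =>
    induction v with
    | zero => simp
    | add v₁ v₂ h₁ h₂ => simp [h₁, h₂]
    | tmul x' y' =>
      rw [innerSesq_tmul, innerSesq_tmul, star_inner, isAdjointPair_leftAction, star_inner]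

theorem innerSesq_self_nonneg (u : E ⊗[ℂ] F) : 0 ≤ innerSesq B C E F u u := by
  obtain ⟨s, rfl⟩ := TensorProduct.exists_finset u
  obtain ⟨D, hD⟩ := exists_gram (B := B) fun i : s => i.1.1
  have h : innerSesq B C E F (∑ i ∈ s, i.1 ⊗ₜ i.2) (∑ i ∈ s, i.1 ⊗ₜ i.2)
      = ∑ k : s, inner C (∑ i : s, leftAction (C := C) (D k i) i.1.2)
          (∑ j : s, leftAction (C := C) (D k j) j.1.2) := by
    rw [← Finset.sum_coe_sort s]
    simp only [map_sum, LinearMap.sum_apply, innerSesq_tmul, hD, inner_sum_left, inner_sum_right,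
      isAdjointPair_leftAction _ _ _, map_mul, Module.End.mul_apply]
    rw [Finset.sum_comm (s := Finset.univ) (t := Finset.univ)]
    exact (Finset.sum_congr rfl fun _ _ => Finset.sum_comm).trans
      (Finset.sum_comm.trans (Finset.sum_congr rfl fun _ _ => Finset.sum_comm))
  rw [h]
  exact Finset.sum_nonneg fun k _ => inner_self_nonneg _

theorem innerSesq_lTensor (c : C) (u v : E ⊗[ℂ] F) :
    innerSesq B C E F u (LinearMap.lTensor E (rightMul C F c) v) = innerSesq B C E F u v * c := by
  induction u with
  | zero => simp
  | add u₁ u₂ h₁ h₂ => simp [h₁, h₂, add_mul]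
  | tmul x y =>
    induction v with
    | zero => simp
    | add v₁ v₂ h₁ h₂ => simp [h₁, h₂, add_mul]
    | tmul x' y' =>
      rw [LinearMap.lTensor_tmul, innerSesq_tmul, innerSesq_tmul, rightMul_apply,
        leftAction_op_smul, SemiInnerProductModule.inner_op_smul_right]

noncomputable instance : SemiInnerProductModule C (Algebraic B C E F) where
  smul c u := LinearMap.lTensor E (rightMul C F c.unop) u
  inner u v := innerSesq B C E F u v
  op_smul_add c u v := map_add (LinearMap.lTensor E (rightMul C F c)) u v
  add_op_smul c c' u := by
    have h : rightMul C F (c + c') = rightMul C F c + rightMul C F c' := by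
      ext y; exact SemiInnerProductModule.add_op_smul c c' y
    change LinearMap.lTensor E (rightMul C F (c + c')) u = _
    rw [h, LinearMap.lTensor_add]
    rfl
  mul_op_smul c c' u := by
    have h : rightMul C F (c * c') = rightMul C F c' ∘ₗ rightMul C F c := by
      ext y; exact SemiInnerProductModule.mul_op_smul c c' y
    change LinearMap.lTensor E (rightMul C F (c * c')) u = _
    rw [h, LinearMap.lTensor_comp]
    rfl
  op_smul_smul c α u := map_smul (LinearMap.lTensor E (rightMul C F c)) α u
  smul_op_smul c α u := by
    have h : rightMul C F (α • c) = α • rightMul C F c := by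
      ext y; exact SemiInnerProductModule.smul_op_smul c α y
    change LinearMap.lTensor E (rightMul C F (α • c)) u = _
    rw [h, LinearMap.lTensor_smul]
    rfl
  inner_add_right u v w := map_add (innerSesq B C E F u) v w
  inner_smul_right α u v := map_smul (innerSesq B C E F u) α v
  inner_op_smul_right c u v := innerSesq_lTensor B C E F c u v
  star_inner := star_innerSesq B C E F
  inner_self_nonneg := innerSesq_self_nonneg B C E F

variable {E F} in
/-- The elementary tensor `x ⊗ y` in the algebraic tensor product. -/
def Algebraic.tmul (x : E) (y : F) : Algebraic B C E F := x ⊗ₜ[ℂ] y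

theorem Algebraic.inner_tmul (x x' : E) (y y' : F) :
    inner C (Algebraic.tmul B C x y) (Algebraic.tmul B C x' y')
      = inner C y (leftAction (C := C) (inner B x x' : B) y') := rfl

end InteriorTensor

/-- The interior tensor product `E ⊙ F` of a Hilbert `B`-module `E` and a C⋆-correspondence `F` from
`B` to `C`: the Hilbert `C`-module obtained from the algebraic tensor product with the semi-inner
product `⟪x ⊗ y, x' ⊗ y'⟫ = ⟪y, ⟪x, x'⟫ y'⟫` by dividing out the vectors of length zero and
completing. -/
abbrev InteriorTensor (B C E F : Type*) [NonUnitalCStarAlgebra B] [PartialOrder B]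
    [StarOrderedRing B] [NonUnitalCStarAlgebra C] [PartialOrder C] [StarOrderedRing C]
    [NormedAddCommGroup E] [NormedSpace ℂ E] [HilbertModule B E]
    [NormedAddCommGroup F] [NormedSpace ℂ F] [HilbertModule C F] [CStarCorrespondence B C F] :
    Type _ :=
  SemiInnerProductModule.Completion C (InteriorTensor.Algebraic B C E F)

section

variable (B C : Type*) {E F : Type*} [NonUnitalCStarAlgebra B] [PartialOrder B]
  [StarOrderedRing B] [NonUnitalCStarAlgebra C] [PartialOrder C] [StarOrderedRing C]
  [NormedAddCommGroup E] [NormedSpace ℂ E] [HilbertModule B E]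
  [NormedAddCommGroup F] [NormedSpace ℂ F] [HilbertModule C F]

/-- The elementary tensor `x ⊙ y` in `E ⊙ F`. -/
noncomputable def InteriorTensor.tmul [CStarCorrespondence B C F] (x : E) (y : F) :
    InteriorTensor B C E F :=
  SemiInnerProductModule.toCompletion C (InteriorTensor.Algebraic B C E F)
    (InteriorTensor.Algebraic.tmul B C x y)

theorem InteriorTensor.inner_tmul [CStarCorrespondence B C F] (x x' : E) (y y' : F) :
    inner C (tmul B C x y) (tmul B C x' y')
      = inner C y (CStarCorrespondence.leftAction (C := C) (inner B x x' : B) y') := by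
  rw [tmul, tmul, SemiInnerProductModule.inner_toCompletion, Algebraic.inner_tmul]

/-! ### CPD-kernels and `𝔎`-families -/

variable {B C}

/-- A map `𝔎` from `S × S` to the bounded linear maps `B → C` is a completely positive definite
kernel if `∑ i j, cᵢ⋆ 𝔎^{σᵢ, σⱼ}(bᵢ⋆ bⱼ) cⱼ ≥ 0` for all finite choices of `σᵢ ∈ S`, `bᵢ ∈ B`,
`cᵢ ∈ C`. -/
def IsCPDKernel {S : Type*} (𝔎 : S → S → B →L[ℂ] C) : Prop :=
  ∀ (n : ℕ) (σ : Fin n → S) (b : Fin n → B) (c : Fin n → C),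
    0 ≤ ∑ i, ∑ j, star (c i) * 𝔎 (σ i) (σ j) (star (b i) * b j) * c j

/-- The maps `K σ : E → F` form a `𝔎`-family if `⟪K^σ x, K^σ' x'⟫ = 𝔎^{σ, σ'}(⟪x, x'⟫)`. -/
def IsKernelFamily {S : Type*} (𝔎 : S → S → B →L[ℂ] C) (K : S → E → F) : Prop :=
  ∀ (σ σ' : S) (x x' : E), inner C (K σ x) (K σ' x') = 𝔎 σ σ' (inner B x x')

end

universe uB uC uE uF uS w

/-! This is a GNS (Kolmogorov) construction for kernels. Given the correspondence and the isometry
`ν`, cancelling `ν` shows `⟪K^σ x, K^σ' x'⟫ = ⟪𝔦 σ, ⟪x, x'⟫ 𝔦 σ'⟫`, so `b ↦ ⟪𝔦 σ, b 𝔦 σ'⟫` is a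
suitable kernel. It is bounded because a `⋆`-representation of a unital C⋆-algebra is contractive
(`inner_representation_self_le`), and completely positive definite because the defining double sum
is `⟪z, z⟫` for `z = ∑ bᵢ 𝔦(σᵢ) cᵢ` (`isCPDKernel_coefficient`).

Conversely, a kernel `𝔎` defines a form on the span of symbols `b ⊗ u` over `σ`, namely `⟪b ⊗ u, b'
⊗ u'⟫ = u⋆ 𝔎^{σ,σ'}(b⋆ b') u'`. The vector `𝔦 σ` should be `1 ⊗ 1`, but `C` may have no unit, so `u`
ranges over the unitization; the form still takes values in `C`, which is an ideal there.
Conjugating by elements of `C` reduces positivity to the hypothesis on `𝔎`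
(`IsCPDKernel.sum_sandwich_nonneg`). The completion is a correspondence, with `B` multiplying the
first factor.

The isometry is determined by `x ⊙ (b ⊗ u) ↦ K^σ(x b) u`. On both sides the inner product is `u⋆
𝔎^{σ,σ'}(b⋆ ⟪x, x'⟫ b') u'`, and an assignment preserving inner products on a total family extends
to a linear isometry (`exists_isometry_of_total`). No linearity of the maps `K^σ` enters: it is a
consequence. -/

namespace SemiInnerProductModule

/-! ### Representations by adjointable operators -/

section representation

variable {B C X : Type*} [CStarAlgebra B] [PartialOrder B] [StarOrderedRing B]
  [NonUnitalCStarAlgebra C] [PartialOrder C] [StarOrderedRing C]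
  [AddCommGroup X] [Module ℂ X] [SemiInnerProductModule C X]

/-- A `⋆`-representation of a unital C⋆-algebra on a semi-inner-product module is contractive. -/
theorem inner_representation_self_le (φ : B →ₙₐ[ℂ] Module.End ℂ X)
    (hφ : ∀ b u v, inner C (φ b u) v = inner C u (φ (star b) v)) (b : B) (u : X) :
    inner C (φ b u) (φ b u) ≤ (‖b‖ ^ 2) • inner C u u := by
  have hinner : ∀ b : B, inner C (φ b u) (φ b u) = inner C u (φ (star b * b) u) := fun b => by
    rw [hφ, map_mul, Module.End.mul_apply]
  have h1 : star b * b ≤ algebraMap ℝ B (‖b‖ ^ 2) := CStarAlgebra.star_mul_le_algebraMap_norm_sq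
  -- With `‖b‖² 1 - b⋆ b = d⋆ d`, positivity of `⟪φ d u, φ d u⟫` is the desired bound, except that
  -- `φ 1 u` stands in place of `u`.
  obtain ⟨d, hd⟩ := exists_eq_star_mul_self _ (sub_nonneg.mpr h1)
  have h2 : inner C (φ d u) (φ d u)
      = (‖b‖ ^ 2) • inner C (φ 1 u) (φ 1 u) - inner C (φ b u) (φ b u) := by
    rw [hinner, ← hd, hinner, hinner, map_sub, LinearMap.sub_apply, inner_sub_right, star_one,
      mul_one, Algebra.algebraMap_eq_smul_one, ← Complex.coe_smul, map_smul, LinearMap.smul_apply,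
      inner_smul_right, Complex.coe_smul]
  have h3 : inner C (φ b u) (φ b u) ≤ (‖b‖ ^ 2) • inner C (φ 1 u) (φ 1 u) := by
    rw [← sub_nonneg, ← h2]
    exact inner_self_nonneg _
  -- `φ` need not preserve the unit; `φ 1` is only a self-adjoint idempotent, so a Pythagorean
  -- identity compares `φ 1 u` with `u`.
  have h4 : inner C (u - φ 1 u) (u - φ 1 u) = inner C u u - inner C (φ 1 u) (φ 1 u) := by
    have h5 : inner C (φ 1 u) u = inner C u (φ 1 u) := by rw [hφ, star_one]
    have h6 : inner C (φ 1 u) (φ 1 u) = inner C u (φ 1 u) := by rw [hinner, star_one, mul_one]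
    rw [inner_sub_left, inner_sub_right, inner_sub_right, h5, h6]
    abel
  have h7 : inner C (φ 1 u) (φ 1 u) ≤ inner C u u := by
    rw [← sub_nonneg, ← h4]
    exact inner_self_nonneg _
  exact h3.trans (smul_le_smul_of_nonneg_left h7 (by positivity))

theorem norm_inner_representation_self_le (φ : B →ₙₐ[ℂ] Module.End ℂ X)
    (hφ : ∀ b u v, inner C (φ b u) v = inner C u (φ (star b) v)) (b : B) (u : X) :
    √‖inner C (φ b u) (φ b u)‖ ≤ ‖b‖ * √‖inner C u u‖ := by
  have h := CStarAlgebra.norm_le_norm_of_nonneg_of_le (inner_self_nonneg _)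
    (inner_representation_self_le φ hφ b u)
  rw [norm_smul, Real.norm_of_nonneg (by positivity)] at h
  refine (Real.sqrt_le_sqrt h).trans_eq ?_
  rw [Real.sqrt_mul (by positivity), Real.sqrt_sq (norm_nonneg b)]

/-- The extension of a `⋆`-representation on a semi-inner-product module to the completion. -/
noncomputable def completionRepresentation (φ : B →ₙₐ[ℂ] Module.End ℂ X) (b : B) :
    Completion C X →L[ℂ] Completion C X :=
  (toCompletion C X ∘ₗ φ b).extendOfNorm (toCompletion C X)

/-- `extendOfNorm` is a genuine extension only under a norm bound; the contractivity estimate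
supplies it with constant `‖b‖`. -/
theorem completionRepresentation_toCompletion (φ : B →ₙₐ[ℂ] Module.End ℂ X)
    (hφ : ∀ b u v, inner C (φ b u) v = inner C u (φ (star b) v)) (b : B) (u : X) :
    completionRepresentation φ b (toCompletion C X u) = toCompletion C X (φ b u) :=
  LinearMap.extendOfNorm_eq (denseRange_toCompletion C X)
    ⟨‖b‖, fun v => by
      simpa only [LinearMap.comp_apply, norm_toCompletion] using
        norm_inner_representation_self_le φ hφ b v⟩ u

theorem inner_completionRepresentation (φ : B →ₙₐ[ℂ] Module.End ℂ X)
    (hφ : ∀ b u v, inner C (φ b u) v = inner C u (φ (star b) v)) (b : B) (u v : Completion C X) :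
    inner C (completionRepresentation φ b u) v
      = inner C u (completionRepresentation φ (star b) v) := by
  have hi := continuous_inner_completion C X
  have hr : ∀ x : Completion C X, Continuous fun y => inner C x y := fun x =>
    hi.comp (Continuous.prodMk_right x)
  have hl : ∀ y : Completion C X, Continuous fun x => inner C x y := fun y =>
    hi.comp (Continuous.prodMk_left y)
  induction u using completion_induction C with
  | hp => exact isClosed_eq ((hl v).comp (completionRepresentation φ b).continuous) (hl _)
  | h u =>
  induction v using completion_induction C with
  | hp => exact isClosed_eq (hr _) ((hr _).comp (completionRepresentation φ (star b)).continuous)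
  | h v =>
    rw [completionRepresentation_toCompletion φ hφ, completionRepresentation_toCompletion φ hφ,
      inner_toCompletion, inner_toCompletion, hφ]

/-- A `⋆`-representation on a semi-inner-product module makes the completion a
C⋆-correspondence. -/
@[reducible]
noncomputable def completionCorrespondence (φ : B →ₙₐ[ℂ] Module.End ℂ X)
    (hφ : ∀ b u v, inner C (φ b u) v = inner C u (φ (star b) v)) :
    CStarCorrespondence B C (Completion C X) where
  leftAction :=
    { toFun := fun b => (completionRepresentation φ b).toLinearMap
      map_smul' := fun α b => by
        ext u
        induction u using completion_induction C with
        | hp => exact isClosed_eq (ContinuousLinearMap.continuous _)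
                  ((ContinuousLinearMap.continuous _).const_smul α)
        | h u => simp [completionRepresentation_toCompletion φ hφ]
      map_zero' := by
        ext u
        induction u using completion_induction C with
        | hp => exact isClosed_eq (ContinuousLinearMap.continuous _) continuous_const
        | h u => simp [completionRepresentation_toCompletion φ hφ]
      map_add' := fun b b' => by
        ext u
        induction u using completion_induction C with
        | hp => exact isClosed_eq (ContinuousLinearMap.continuous _)
                  ((ContinuousLinearMap.continuous _).add (ContinuousLinearMap.continuous _))
        | h u => simp [completionRepresentation_toCompletion φ hφ]
      map_mul' := fun b b' => by
        ext u
        induction u using completion_induction C with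
        | hp => exact isClosed_eq (ContinuousLinearMap.continuous _)
                  ((ContinuousLinearMap.continuous _).comp (ContinuousLinearMap.continuous _))
        | h u => simp [completionRepresentation_toCompletion φ hφ] }
  isAdjointPair_leftAction := inner_completionRepresentation φ hφ

theorem leftAction_toCompletion (φ : B →ₙₐ[ℂ] Module.End ℂ X)
    (hφ : ∀ b u v, inner C (φ b u) v = inner C u (φ (star b) v)) (b : B) (u : X) :
    (completionCorrespondence φ hφ).leftAction b (toCompletion C X u)
      = toCompletion C X (φ b u) :=
  completionRepresentation_toCompletion φ hφ b u

end representation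

end SemiInnerProductModule

/-! ### Extension of inner-product-preserving maps from total families -/

namespace HilbertModule

open SemiInnerProductModule

variable {C E F : Type*} [NonUnitalCStarAlgebra C] [PartialOrder C] [StarOrderedRing C]
  [NormedAddCommGroup E] [NormedSpace ℂ E] [HilbertModule C E]
  [NormedAddCommGroup F] [NormedSpace ℂ F] [HilbertModule C F]

variable (C) in
theorem norm_inner_le (x y : E) : ‖inner C x y‖ ≤ ‖x‖ * ‖y‖ := by
  rw [norm_eq (B := C) x, norm_eq (B := C) y, ← Real.sqrt_mul (norm_nonneg _)]
  exact Real.le_sqrt_of_sq_le (norm_inner_sq_le x y)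

variable (C E) in
theorem continuous_inner : Continuous fun p : E × E => inner C p.1 p.2 := by
  have h : Continuous fun p : E × E => (LinearMap.mkContinuous₂ (innerₛₗ C E) 1
      fun x y => by rw [one_mul]; exact norm_inner_le C x y) p.1 p.2 := by fun_prop
  exact h

/-- A map defined on a total family and preserving inner products extends to an isometry. -/
theorem exists_isometry_of_total {ι : Type*} (e : ι → E) (f : ι → F)
    (he : Dense (Submodule.span ℂ (Set.range e) : Set E))
    (hef : ∀ i j, inner C (f i) (f j) = inner C (e i) (e j)) :
    ∃ ν : E →ₗ[ℂ] F, IsHilbertModuleIsometry C ν ∧ ∀ i, ν (e i) = f i := by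
  let e' := Finsupp.linearCombination ℂ e
  let f' := Finsupp.linearCombination ℂ f
  have hd : DenseRange e' := by
    rw [← Finsupp.range_linearCombination] at he
    exact he
  have hi : ∀ u v, inner C (f' u) (f' v) = inner C (e' u) (e' v) := fun u v => by
    simp only [e', f', Finsupp.linearCombination_apply, Finsupp.sum, inner_sum_left,
      inner_sum_right, SemiInnerProductModule.inner_smul_left,
      SemiInnerProductModule.inner_smul_right, hef]
  have hn : ∀ u, ‖f' u‖ ≤ 1 * ‖e' u‖ := fun u => by
    rw [one_mul, norm_eq (B := C) (f' u), hi, ← norm_eq]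
  -- The bound makes the extension well defined: a formal combination that `e'` sends to zero is
  -- also sent to zero by `f'`.
  have hν : ∀ u, f'.extendOfNorm e' (e' u) = f' u := LinearMap.extendOfNorm_eq hd ⟨1, hn⟩
  have hc := (f'.extendOfNorm e').continuous
  refine ⟨(f'.extendOfNorm e').toLinearMap, fun u v => ?_, fun i => ?_⟩
  · change inner C (f'.extendOfNorm e' u) (f'.extendOfNorm e' v) = inner C u v
    refine hd.induction_on u (isClosed_eq ((continuous_inner C F).comp (hc.prodMk continuous_const))
      ((continuous_inner C E).comp (continuous_id.prodMk continuous_const))) fun u => ?_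
    refine hd.induction_on v (isClosed_eq ((continuous_inner C F).comp (continuous_const.prodMk hc))
      ((continuous_inner C E).comp (continuous_const.prodMk continuous_id))) fun v => ?_
    rw [hν, hν, hi]
  · simpa [e', f'] using hν (Finsupp.single i 1)

end HilbertModule

/-! ### Boundedness of the left action, coefficient kernels, total families in `E ⊙ F` -/

namespace CStarCorrespondence

open SemiInnerProductModule HilbertModule

variable {B C E F : Type*} [CStarAlgebra B] [PartialOrder B] [StarOrderedRing B]
  [NonUnitalCStarAlgebra C] [PartialOrder C] [StarOrderedRing C]
  [NormedAddCommGroup E] [NormedSpace ℂ E] [HilbertModule B E]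
  [NormedAddCommGroup F] [NormedSpace ℂ F] [HilbertModule C F] [CStarCorrespondence B C F]

/-- Continuity is not part of the definition of a correspondence; the existence of adjoints and the
unit of `B` force it. -/
theorem norm_leftAction_apply_le (b : B) (y : F) :
    ‖leftAction (C := C) b y‖ ≤ ‖b‖ * ‖y‖ := by
  rw [norm_eq (B := C), norm_eq (B := C) y]
  exact norm_inner_representation_self_le _ isAdjointPair_leftAction b y

variable (B C) in
/-- The bounded map `b ↦ ⟪y, b y'⟫`. -/
noncomputable def coefficient (y y' : F) : B →L[ℂ] C :=
  LinearMap.mkContinuous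
    { toFun := fun b => inner C y (leftAction (C := C) b y')
      map_add' := fun b b' => by
        rw [map_add, LinearMap.add_apply, SemiInnerProductModule.inner_add_right]
      map_smul' := fun α b => by
        rw [map_smul, LinearMap.smul_apply, SemiInnerProductModule.inner_smul_right]; rfl }
    (‖y‖ * ‖y'‖) fun b => (norm_inner_le C _ _).trans <| by
      rw [mul_assoc, mul_comm ‖y'‖]
      exact mul_le_mul_of_nonneg_left (norm_leftAction_apply_le b y') (norm_nonneg y)

theorem coefficient_apply (y y' : F) (b : B) :
    coefficient B C y y' b = inner C y (leftAction (C := C) b y') := rfl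

/-- Moving `bᵢ` and `cᵢ` into the inner product turns the double sum into `⟪z, z⟫` with `z = ∑ bᵢ
y(σᵢ) cᵢ`. -/
theorem isCPDKernel_coefficient {S : Type*} (y : S → F) :
    IsCPDKernel fun σ σ' => coefficient B C (y σ) (y σ') := fun n σ b c => by
  have h : ∑ i, ∑ j, star (c i) * coefficient B C (y (σ i)) (y (σ j)) (star (b i) * b j) * c j
      = inner C (∑ i, op (c i) • leftAction (C := C) (b i) (y (σ i)))
          (∑ i, op (c i) • leftAction (C := C) (b i) (y (σ i))) := by
    simp only [inner_sum_left, inner_sum_right, inner_op_smul_left, coefficient_apply,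
      SemiInnerProductModule.inner_op_smul_right, isAdjointPair_leftAction _ _ _, map_mul,
      Module.End.mul_apply, mul_assoc, Finset.sum_mul]
    exact Finset.sum_comm
  rw [h]
  exact SemiInnerProductModule.inner_self_nonneg _

variable (B C E F) in
-- Follows from `‖x ⊙ y‖² = ‖⟪y, ⟪x, x⟫ y⟫‖ ≤ ‖⟪x, x⟫‖ ‖y‖²`. It allows second factors to be
-- approximated from a total family.
theorem continuous_tmul (x : E) : Continuous fun y : F => InteriorTensor.tmul B C x y := by
  let f : F →ₗ[ℂ] InteriorTensor B C E F :=
    toCompletion C (InteriorTensor.Algebraic B C E F) ∘ₗ TensorProduct.mk ℂ E F x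
  have hf : ∀ y, ‖f y‖ ≤ √‖(inner B x x : B)‖ * ‖y‖ := fun y => by
    rw [norm_eq (B := C) (f y)]
    refine Real.sqrt_le_iff.mpr ⟨by positivity, ?_⟩
    have h : inner C (f y) (f y) = inner C y (leftAction (C := C) (inner B x x : B) y) :=
      InteriorTensor.inner_tmul B C x x y y
    rw [h, mul_pow, Real.sq_sqrt (norm_nonneg _)]
    calc _ ≤ ‖y‖ * (‖(inner B x x : B)‖ * ‖y‖) := (norm_inner_le C _ _).trans
          (mul_le_mul_of_nonneg_left (norm_leftAction_apply_le _ _) (norm_nonneg _))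
      _ = _ := by ring
  exact (f.mkContinuous _ hf).continuous

variable (E) in
/-- Elementary tensors with second factors from a total family are total. -/
theorem dense_span_tmul {ι : Type*} (y : ι → F)
    (hy : Dense (Submodule.span ℂ (Set.range y) : Set F)) :
    Dense (Submodule.span ℂ (Set.range fun p : E × ι => InteriorTensor.tmul B C p.1 (y p.2)) :
      Set (InteriorTensor B C E F)) := by
  set V := Submodule.span ℂ (Set.range fun p : E × ι => InteriorTensor.tmul B C p.1 (y p.2))
  let V' : Submodule ℂ (InteriorTensor B C E F) := V.topologicalClosure
  have h1 : ∀ (x : E) (z : F), InteriorTensor.tmul B C x z ∈ V' := by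
    intro x z
    let f : F →ₗ[ℂ] InteriorTensor B C E F :=
      toCompletion C (InteriorTensor.Algebraic B C E F) ∘ₗ TensorProduct.mk ℂ E F x
    -- For fixed `x`, the vectors `z` with `x ⊙ z ∈ V'` form a closed subspace containing the total
    -- family.
    refine hy.induction (fun z hz => ?_)
      (V.isClosed_topologicalClosure.preimage (continuous_tmul B C E F x)) z
    have h : Submodule.span ℂ (Set.range y) ≤ V'.comap f := by
      rw [Submodule.span_le]
      rintro _ ⟨i, rfl⟩
      exact V.le_topologicalClosure (Submodule.subset_span ⟨(x, i), rfl⟩)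
    exact h hz
  have h2 : ∀ u : E ⊗[ℂ] F,
      toCompletion C (InteriorTensor.Algebraic B C E F) u ∈ V' := by
    intro u
    induction u with
    | zero => exact V'.zero_mem
    | tmul x z => exact h1 x z
    | add u v hu hv =>
      have h := map_add (toCompletion C (InteriorTensor.Algebraic B C E F)) u v
      exact h ▸ add_mem hu hv
  intro u
  refine (denseRange_toCompletion C (InteriorTensor.Algebraic B C E F)).induction_on u
    V.isClosed_topologicalClosure fun u => h2 u

end CStarCorrespondence

/-! ### The correspondence generated by a CPD-kernel -/

section positivity

variable {C : Type*} [NonUnitalCStarAlgebra C] [PartialOrder C] [StarOrderedRing C]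

/-- An element is positive if all its conjugates are. -/
theorem nonneg_of_forall_star_conjugate_nonneg {x : C} (h : ∀ d : C, 0 ≤ star d * x * d) :
    0 ≤ x := by
  have hl := CStarAlgebra.increasingApproximateUnit C
  have := hl.neBot
  -- Along the approximate unit, `d x d = d (x d - x) + d x` tends to `x`; the first summand
  -- vanishes in the limit because `‖d‖ ≤ 1` eventually.
  have h1 : Filter.Tendsto (fun d => d * (x * d - x)) (CStarAlgebra.approximateUnit C)
      (nhds 0) := by
    refine squeeze_zero_norm' (a := fun d => ‖x * d - x‖) ?_ ?_
    · filter_upwards [hl.eventually_norm] with d hd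
      exact (norm_mul_le _ _).trans (mul_le_of_le_one_left (norm_nonneg _) hd)
    · exact tendsto_iff_norm_sub_tendsto_zero.mp (hl.tendsto_mul_left x)
  have h2 : Filter.Tendsto (fun d => d * x * d) (CStarAlgebra.approximateUnit C) (nhds x) := by
    simpa [mul_sub, mul_assoc] using h1.add (hl.tendsto_mul_right x)
  refine ge_of_tendsto h2 ?_
  filter_upwards [hl.eventually_star_eq] with d hd
  simpa [hd] using h d

/-- A positive sesquilinear form is hermitian. -/
theorem star_sesq_of_nonneg {X : Type*} [AddCommGroup X] [Module ℂ X] (H : X →ₗ⋆[ℂ] X →ₗ[ℂ] C)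
    (hH : ∀ u, 0 ≤ H u u) (u v : X) : star (H u v) = H v u := by
  have hs : ∀ u, star (H u u) = H u u := fun u => (IsSelfAdjoint.of_nonneg (hH u)).star_eq
  -- Polarization: `u + v` controls the sum of `H u v` and `H v u`, and `u + i v` controls their
  -- difference.
  have h1 := hs (u + v)
  have h2 := hs (u + Complex.I • v)
  simp only [map_add, LinearMap.add_apply, star_add, hs, map_smul, LinearMap.map_smulₛₗ,
    LinearMap.smul_apply, star_smul, Complex.star_def, Complex.conj_I, map_neg, neg_neg]
    at h1 h2
  have h3 : star (H u v) + star (H v u) = H u v + H v u := by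
    rw [← sub_eq_zero] at h1 ⊢
    rw [← h1]
    abel
  have h4 : Complex.I • (star (H v u) - star (H u v)) = Complex.I • (H u v - H v u) := by
    rw [← sub_eq_zero] at h2 ⊢
    rw [← h2]
    module
  have h5 := smul_right_injective C Complex.I_ne_zero h4
  have h6 : (2 : ℂ) • star (H u v) = (2 : ℂ) • H v u := by
    have : (2 : ℂ) • star (H u v) = (star (H u v) + star (H v u))
        - (star (H v u) - star (H u v)) := by module
    rw [this, h3]
    rw [show star (H v u) - star (H u v) = H u v - H v u from h5]
    module
  exact smul_right_injective C two_ne_zero h6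

end positivity

/-! ### Products in the unitization with middle factor in `C` -/

namespace Unitization

variable {C : Type*} [NonUnitalCStarAlgebra C]

/-- The product `u a v` in `C` of an element `a` of `C` with elements `u, v` of the unitization. -/
def sandwich (u : Unitization ℂ C) (a : C) (v : Unitization ℂ C) : C :=
  (u * (a : Unitization ℂ C) * v).snd

/-- `C` is an ideal of its unitization, so the scalar part of the product is zero and passing to
`snd` loses nothing. Identities for `sandwich` can thus be checked in the unitization. -/
theorem inr_sandwich (u : Unitization ℂ C) (a : C) (v : Unitization ℂ C) :
    ((sandwich u a v : C) : Unitization ℂ C) = u * (a : Unitization ℂ C) * v := by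
  ext <;> simp [sandwich]

theorem sandwich_add_left (u u' : Unitization ℂ C) (a : C) (v : Unitization ℂ C) :
    sandwich (u + u') a v = sandwich u a v + sandwich u' a v := by
  simp only [sandwich, add_mul, snd_add]

theorem sandwich_add_mid (u : Unitization ℂ C) (a a' : C) (v : Unitization ℂ C) :
    sandwich u (a + a') v = sandwich u a v + sandwich u a' v := by
  simp only [sandwich, inr_add, add_mul, mul_add, snd_add]

theorem sandwich_add_right (u : Unitization ℂ C) (a : C) (v v' : Unitization ℂ C) :
    sandwich u a (v + v') = sandwich u a v + sandwich u a v' := by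
  simp only [sandwich, mul_add, snd_add]

theorem sandwich_smul_left (α : ℂ) (u : Unitization ℂ C) (a : C) (v : Unitization ℂ C) :
    sandwich (α • u) a v = α • sandwich u a v := by
  simp only [sandwich, smul_mul_assoc, snd_smul]

theorem sandwich_smul_mid (α : ℂ) (u : Unitization ℂ C) (a : C) (v : Unitization ℂ C) :
    sandwich u (α • a) v = α • sandwich u a v := by
  simp only [sandwich, inr_smul, smul_mul_assoc, mul_smul_comm, snd_smul]

theorem sandwich_smul_right (α : ℂ) (u : Unitization ℂ C) (a : C) (v : Unitization ℂ C) :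
    sandwich u a (α • v) = α • sandwich u a v := by
  simp only [sandwich, mul_smul_comm, snd_smul]

theorem sandwich_mul_inr (u : Unitization ℂ C) (a : C) (v : Unitization ℂ C) (c : C) :
    sandwich u a (v * (c : Unitization ℂ C)) = sandwich u a v * c := by
  apply inr_injective (R := ℂ)
  rw [inr_sandwich, inr_mul, inr_sandwich, mul_assoc _ v]

end Unitization

/-! ### The semi-inner-product module of a CPD-kernel -/

section kernel

open Unitization

variable {B C S : Type*} [CStarAlgebra B] [NonUnitalCStarAlgebra C] (𝔎 : S → S → B →L[ℂ] C)

/-- The sesquilinear form `(f, g) ↦ ∑ 𝔎^{σ, σ'}(f(σ)⋆ g(σ'))`. -/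
noncomputable def kernelForm : (S →₀ B) →ₗ⋆[ℂ] (S →₀ B) →ₗ[ℂ] C where
  toFun f := f.sum fun σ b => Finsupp.lsum ℂ fun σ' =>
    (𝔎 σ σ').toLinearMap ∘ₗ LinearMap.mulLeft ℂ (star b)
  map_add' f g := by
    refine Finsupp.sum_add_index' (fun σ => ?_) fun σ b b' => ?_
    · ext; simp
    · ext; simp [add_mul]
  map_smul' α f := by
    rw [Finsupp.sum_smul_index' (fun σ => by ext; simp), Finsupp.smul_sum]
    refine Finsupp.sum_congr fun σ _ => ?_
    ext; simp

theorem kernelForm_single (σ σ' : S) (b b' : B) :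
    kernelForm 𝔎 (Finsupp.single σ b) (Finsupp.single σ' b') = 𝔎 σ σ' (star b * b') := by
  simp only [kernelForm, LinearMap.coe_mk, AddHom.coe_mk]
  rw [Finsupp.sum_single_index (by ext; simp)]
  simp

/-- For fixed `f, u`, the linear map `g ⊗ v ↦ u⋆ 𝔎(f, g) v`. -/
noncomputable def kernelInnerAux (f : S →₀ B) (u : Unitization ℂ C) :
    (S →₀ B) ⊗[ℂ] Unitization ℂ C →ₗ[ℂ] C :=
  TensorProduct.lift (LinearMap.mk₂ ℂ (fun g v => sandwich (star u) (kernelForm 𝔎 f g) v)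
    (fun g g' v => by rw [map_add, sandwich_add_mid])
    (fun α g v => by rw [map_smul, sandwich_smul_mid])
    (fun g v v' => by rw [sandwich_add_right])
    (fun α g v => by rw [sandwich_smul_right]))

theorem kernelInnerAux_tmul (f g : S →₀ B) (u v : Unitization ℂ C) :
    kernelInnerAux 𝔎 f u (g ⊗ₜ v) = sandwich (star u) (kernelForm 𝔎 f g) v := rfl

/-- The sesquilinear form `⟪f ⊗ u, g ⊗ v⟫ = u⋆ 𝔎(f, g) v`. -/
noncomputable def kernelInner :
    (S →₀ B) ⊗[ℂ] Unitization ℂ C →ₗ⋆[ℂ] (S →₀ B) ⊗[ℂ] Unitization ℂ C →ₗ[ℂ] C :=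
  TensorProduct.lift (LinearMap.mk₂'ₛₗ (starRingEnd ℂ) (starRingEnd ℂ) (kernelInnerAux 𝔎)
    (fun f f' u => TensorProduct.ext' fun g v => by
      simp only [kernelInnerAux_tmul, map_add, LinearMap.add_apply, sandwich_add_mid])
    (fun α f u => TensorProduct.ext' fun g v => by
      simp only [kernelInnerAux_tmul, LinearMap.map_smulₛₗ, LinearMap.smul_apply,
        sandwich_smul_mid])
    (fun f u u' => TensorProduct.ext' fun g v => by
      simp only [kernelInnerAux_tmul, star_add, LinearMap.add_apply, sandwich_add_left])
    (fun α f u => TensorProduct.ext' fun g v => by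
      simp only [kernelInnerAux_tmul, star_smul, LinearMap.smul_apply, sandwich_smul_left]
      rfl))

theorem kernelInner_tmul (f g : S →₀ B) (u v : Unitization ℂ C) :
    kernelInner 𝔎 (f ⊗ₜ u) (g ⊗ₜ v) = sandwich (star u) (kernelForm 𝔎 f g) v := rfl

/-- Brings a tensor into the shape of the data in `IsCPDKernel`. Points `σ i` may repeat there, so
sums are formed by mere concatenation of lists. -/
theorem exists_eq_sum_single_tmul (x : (S →₀ B) ⊗[ℂ] Unitization ℂ C) :
    ∃ (n : ℕ) (σ : Fin n → S) (b : Fin n → B) (u : Fin n → Unitization ℂ C),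
      x = ∑ i, Finsupp.single (σ i) (b i) ⊗ₜ[ℂ] u i := by
  have hadd : ∀ x y : (S →₀ B) ⊗[ℂ] Unitization ℂ C,
      (∃ (n : ℕ) (σ : Fin n → S) (b : Fin n → B) (u : Fin n → Unitization ℂ C),
        x = ∑ i, Finsupp.single (σ i) (b i) ⊗ₜ[ℂ] u i) →
      (∃ (n : ℕ) (σ : Fin n → S) (b : Fin n → B) (u : Fin n → Unitization ℂ C),
        y = ∑ i, Finsupp.single (σ i) (b i) ⊗ₜ[ℂ] u i) →
      ∃ (n : ℕ) (σ : Fin n → S) (b : Fin n → B) (u : Fin n → Unitization ℂ C),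
        x + y = ∑ i, Finsupp.single (σ i) (b i) ⊗ₜ[ℂ] u i := by
    rintro _ _ ⟨n, σ, b, u, rfl⟩ ⟨m, τ, c, v, rfl⟩
    exact ⟨n + m, Fin.append σ τ, Fin.append b c, Fin.append u v, by simp [Fin.sum_univ_add]⟩
  induction x with
  | zero => exact ⟨0, Fin.elim0, Fin.elim0, Fin.elim0, by simp⟩
  | add x y hx hy => exact hadd x y hx hy
  | tmul f u =>
    induction f using Finsupp.induction_linear with
    | zero => exact ⟨0, Fin.elim0, Fin.elim0, Fin.elim0, by simp⟩
    | add f g hf hg => rw [TensorProduct.add_tmul]; exact hadd _ _ hf hg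
    | single σ b => exact ⟨1, fun _ => σ, fun _ => b, fun _ => u, by simp⟩

theorem kernelInner_lTensor (c : C) (x y : (S →₀ B) ⊗[ℂ] Unitization ℂ C) :
    kernelInner 𝔎 x (LinearMap.lTensor (S →₀ B)
        (LinearMap.mulRight ℂ (c : Unitization ℂ C)) y) = kernelInner 𝔎 x y * c := by
  induction x with
  | zero => simp
  | add x x' h h' => simp only [map_add, LinearMap.add_apply, h, h', add_mul]
  | tmul f u =>
    induction y with
    | zero => simp
    | add y y' h h' => simp only [map_add, h, h', add_mul]
    | tmul g v =>
      rw [LinearMap.lTensor_tmul, LinearMap.mulRight_apply, kernelInner_tmul, kernelInner_tmul,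
        sandwich_mul_inr]

variable [PartialOrder C]

/-- The defining inequality of a CPD-kernel holds for coefficients in the unitization. -/
theorem IsCPDKernel.sum_sandwich_nonneg [StarOrderedRing C] {𝔎 : S → S → B →L[ℂ] C} (h𝔎 : IsCPDKernel 𝔎) (n : ℕ)
    (σ : Fin n → S) (b : Fin n → B) (u : Fin n → Unitization ℂ C) :
    0 ≤ ∑ i, ∑ j, sandwich (star (u i)) (𝔎 (σ i) (σ j) (star (b i) * b j)) (u j) := by
  -- Conjugation by `d ∈ C` replaces each `u i` by `u i * d`, which lies in `C`, where the
  -- hypothesis on the kernel applies.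
  refine nonneg_of_forall_star_conjugate_nonneg fun d => ?_
  have hu : ∀ i, (((u i * (d : Unitization ℂ C)).snd : C) : Unitization ℂ C) = u i * d :=
    fun i => by ext <;> simp
  convert h𝔎 n σ b fun i => (u i * (d : Unitization ℂ C)).snd using 1
  simp only [Finset.mul_sum, Finset.sum_mul]
  refine Finset.sum_congr rfl fun i _ => Finset.sum_congr rfl fun j _ => ?_
  apply inr_injective (R := ℂ)
  simp only [inr_mul, inr_sandwich, inr_star, hu, star_mul, mul_assoc]

theorem kernelInner_self_nonneg [StarOrderedRing C] {𝔎 : S → S → B →L[ℂ] C} (h𝔎 : IsCPDKernel 𝔎)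
    (x : (S →₀ B) ⊗[ℂ] Unitization ℂ C) : 0 ≤ kernelInner 𝔎 x x := by
  obtain ⟨n, σ, b, u, rfl⟩ := exists_eq_sum_single_tmul x
  simp only [map_sum, LinearMap.sum_apply, kernelInner_tmul, kernelForm_single]
  rw [Finset.sum_comm]
  exact h𝔎.sum_sandwich_nonneg n σ b u

/-- The algebraic tensor product of finitely supported functions `S → B` and the unitization of
`C`, carrying the semi-inner product defined by a CPD-kernel. -/
def KernelModule {𝔎 : S → S → B →L[ℂ] C} (_h𝔎 : IsCPDKernel 𝔎) : Type _ :=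
  (S →₀ B) ⊗[ℂ] Unitization ℂ C

namespace KernelModule

variable {𝔎} (h𝔎 : IsCPDKernel 𝔎)

noncomputable instance : AddCommGroup (KernelModule h𝔎) :=
  inferInstanceAs (AddCommGroup ((S →₀ B) ⊗[ℂ] Unitization ℂ C))

noncomputable instance : Module ℂ (KernelModule h𝔎) :=
  inferInstanceAs (Module ℂ ((S →₀ B) ⊗[ℂ] Unitization ℂ C))

/-- The generator `b ⊗ u` over `σ`. -/
noncomputable def generator (σ : S) (b : B) (u : Unitization ℂ C) : KernelModule h𝔎 :=
  Finsupp.single σ b ⊗ₜ[ℂ] u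

theorem span_generator :
    Submodule.span ℂ (Set.range fun p : S × B × Unitization ℂ C =>
      generator h𝔎 p.1 p.2.1 p.2.2) = ⊤ := by
  refine eq_top_iff.mpr fun x _ => ?_
  obtain ⟨n, σ, b, u, rfl⟩ := exists_eq_sum_single_tmul (B := B) (C := C) x
  exact Submodule.sum_mem _ fun i _ => Submodule.subset_span ⟨(σ i, b i, u i), rfl⟩

/-- The left action of `B`. -/
noncomputable def representation : B →ₙₐ[ℂ] Module.End ℂ (KernelModule h𝔎) :=
  ((Module.End.rTensorAlgHom ℂ (S →₀ B) (Unitization ℂ C)).comp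
    (Algebra.lsmul ℂ ℂ (S →₀ B))).toNonUnitalAlgHom

theorem representation_generator (a : B) (σ : S) (b : B) (u : Unitization ℂ C) :
    representation h𝔎 a (generator h𝔎 σ b u) = generator h𝔎 σ (a * b) u := by
  change (a • Finsupp.single σ b) ⊗ₜ[ℂ] u = _
  rw [Finsupp.smul_single]
  rfl

variable [StarOrderedRing C]

noncomputable instance : SemiInnerProductModule C (KernelModule h𝔎) where
  smul c x := LinearMap.lTensor (S →₀ B) (LinearMap.mulRight ℂ (c.unop : Unitization ℂ C)) x
  inner x y := kernelInner 𝔎 x y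
  op_smul_add c x y := map_add (LinearMap.lTensor _ (LinearMap.mulRight ℂ _)) x y
  add_op_smul c c' x := by
    have h : LinearMap.mulRight ℂ ((c + c' : C) : Unitization ℂ C)
        = LinearMap.mulRight ℂ (c : Unitization ℂ C) + LinearMap.mulRight ℂ (c' : Unitization ℂ C)
      := by ext <;> simp [mul_add]
    change LinearMap.lTensor (S →₀ B) (LinearMap.mulRight ℂ ((c + c' : C) : Unitization ℂ C)) x = _
    rw [h, LinearMap.lTensor_add]
    rfl
  mul_op_smul c c' x := by
    change LinearMap.lTensor (S →₀ B) (LinearMap.mulRight ℂ ((c * c' : C) : Unitization ℂ C)) x = _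
    rw [inr_mul, LinearMap.mulRight_mul, LinearMap.lTensor_comp]
    rfl
  op_smul_smul c α x := map_smul (LinearMap.lTensor _ (LinearMap.mulRight ℂ _)) α x
  smul_op_smul c α x := by
    have h : LinearMap.mulRight ℂ ((α • c : C) : Unitization ℂ C)
        = α • LinearMap.mulRight ℂ (c : Unitization ℂ C) := by ext <;> simp
    change LinearMap.lTensor (S →₀ B) (LinearMap.mulRight ℂ ((α • c : C) : Unitization ℂ C)) x = _
    rw [h, LinearMap.lTensor_smul]
    rfl
  inner_add_right x y z := map_add (kernelInner 𝔎 x) y z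
  inner_smul_right α x y := map_smul (kernelInner 𝔎 x) α y
  inner_op_smul_right c x y := kernelInner_lTensor 𝔎 c x y
  -- The definition of a CPD-kernel contains no symmetry condition; it is recovered from positivity
  -- by polarization.
  star_inner x y := star_sesq_of_nonneg (kernelInner 𝔎) (kernelInner_self_nonneg h𝔎) x y
  inner_self_nonneg := kernelInner_self_nonneg h𝔎

theorem inner_generator (σ σ' : S) (b b' : B) (u u' : Unitization ℂ C) :
    inner C (generator h𝔎 σ b u) (generator h𝔎 σ' b' u')
      = sandwich (star u) (𝔎 σ σ' (star b * b')) u' := by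
  rw [← kernelForm_single]
  rfl

/-- On generators this is `(a b)⋆ b' = b⋆ (a⋆ b')` inside the kernel; sesquilinearity does the rest.
-/
theorem inner_representation (a : B) (x y : KernelModule h𝔎) :
    inner C (representation h𝔎 a x) y = inner C x (representation h𝔎 (star a) y) := by
  have hx : x ∈ Submodule.span ℂ _ := span_generator h𝔎 ▸ Submodule.mem_top
  have hy : y ∈ Submodule.span ℂ _ := span_generator h𝔎 ▸ Submodule.mem_top
  induction hx, hy using Submodule.span_induction₂ with
  | mem_mem x y hx hy =>
    obtain ⟨p, rfl⟩ := hx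
    obtain ⟨q, rfl⟩ := hy
    simp only [representation_generator, inner_generator, star_mul, mul_assoc]
  | zero_left y hy => simp [SemiInnerProductModule.inner_zero_left]
  | zero_right x hx => simp [SemiInnerProductModule.inner_zero_right]
  | add_left x x' y _ _ _ h h' => simp only [map_add, SemiInnerProductModule.inner_add_left, h, h']
  | add_right x y y' _ _ _ h h' =>
    simp only [map_add, SemiInnerProductModule.inner_add_right, h, h']
  | smul_left α x y _ _ h => simp only [map_smul, SemiInnerProductModule.inner_smul_left, h]
  | smul_right α x y _ _ h => simp only [map_smul, SemiInnerProductModule.inner_smul_right, h]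

end KernelModule

end kernel

namespace KernelModule

open SemiInnerProductModule

variable {B C S : Type*} [CStarAlgebra B] [NonUnitalCStarAlgebra C] [PartialOrder C]
  [StarOrderedRing C] {𝔎 : S → S → B →L[ℂ] C} (h𝔎 : IsCPDKernel 𝔎)

/-- The images of the generators are total in the completion. -/
theorem dense_span_generator :
    Dense (Submodule.span ℂ (Set.range fun p : S × B × Unitization ℂ C =>
      toCompletion C (KernelModule h𝔎) (generator h𝔎 p.1 p.2.1 p.2.2)) :
        Set (Completion C (KernelModule h𝔎))) := by
  have h := congrArg (Submodule.map (toCompletion C (KernelModule h𝔎))) (span_generator h𝔎)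
  rw [Submodule.map_span, ← Set.range_comp, Submodule.map_top] at h
  have h' := denseRange_toCompletion C (KernelModule h𝔎)
  rw [DenseRange, ← LinearMap.coe_range, ← h] at h'
  exact h'

end KernelModule

/-! ### The unitization acting on a Hilbert module -/

namespace HilbertModule

open SemiInnerProductModule Unitization

/-- The module axioms do not mention the unit. Since `x 1 - x` is orthogonal to every vector,
definiteness of the inner product makes it zero. -/
theorem op_one_smul {B E : Type*} [CStarAlgebra B] [PartialOrder B] [StarOrderedRing B]
    [NormedAddCommGroup E] [NormedSpace ℂ E] [HilbertModule B E] (x : E) : op (1 : B) • x = x := by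
  rw [← sub_eq_zero]
  refine eq_zero_of_inner_self (B := B) _ ?_
  rw [SemiInnerProductModule.inner_sub_right, inner_op_smul_right, mul_one, sub_self]

variable {C F : Type*} [NonUnitalCStarAlgebra C] [PartialOrder C] [StarOrderedRing C]
  [NormedAddCommGroup F] [NormedSpace ℂ F] [HilbertModule C F]

/-- The right action of the unitization of `C` on a Hilbert `C`-module. -/
def unitizationSMul (y : F) (u : Unitization ℂ C) : F := u.fst • y + op u.snd • y

theorem unitizationSMul_one (y : F) : unitizationSMul y (1 : Unitization ℂ C) = y := by
  have h : op (0 : C) • y = 0 := by simpa using add_op_smul (0 : C) 0 y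
  rw [unitizationSMul, fst_one, snd_one, h, one_smul, add_zero]

/-- The counterpart in `F` of `inner_generator`: the four terms of the expansion are those of the
product `u⋆ ⟪y, y'⟫ u'` in the unitization. -/
theorem inner_unitizationSMul (y y' : F) (u u' : Unitization ℂ C) :
    inner C (unitizationSMul y u) (unitizationSMul y' u')
      = sandwich (star u) (inner C y y') u' := by
  simp only [unitizationSMul, SemiInnerProductModule.inner_add_left,
    SemiInnerProductModule.inner_add_right, SemiInnerProductModule.inner_smul_left,
    SemiInnerProductModule.inner_smul_right, inner_op_smul_left, inner_op_smul_right, sandwich,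
    snd_mul, fst_mul, snd_inr, fst_inr, fst_star, snd_star, mul_zero, zero_smul, add_zero,
    zero_add, add_mul, smul_mul_assoc, smul_add]

end HilbertModule

/-! ### Kernel families and isometries of interior tensor products -/

section families

open SemiInnerProductModule HilbertModule KernelModule CStarCorrespondence

variable {B C E F S : Type*} [CStarAlgebra B] [PartialOrder B] [StarOrderedRing B]
  [NonUnitalCStarAlgebra C] [PartialOrder C] [StarOrderedRing C]
  [NormedAddCommGroup E] [NormedSpace ℂ E] [HilbertModule B E]
  [NormedAddCommGroup F] [NormedSpace ℂ F] [HilbertModule C F]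

/-- A family of maps factoring through an isometry of an interior tensor product is a kernel
family. -/
theorem isKernelFamily_coefficient {𝓕 : Type*} [NormedAddCommGroup 𝓕] [NormedSpace ℂ 𝓕]
    [HilbertModule C 𝓕] [CStarCorrespondence B C 𝓕] {K : S → E → F} {y : S → 𝓕}
    {ν : InteriorTensor B C E 𝓕 →ₗ[ℂ] F} (hν : IsHilbertModuleIsometry C ν)
    (hK : ∀ x σ, ν (InteriorTensor.tmul B C x (y σ)) = K σ x) :
    IsKernelFamily (fun σ σ' => coefficient B C (y σ) (y σ')) K := fun σ σ' x x' => by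
  rw [← hK, ← hK, hν, InteriorTensor.inner_tmul, coefficient_apply]

/-- The inner product of elementary tensors of generators. -/
theorem inner_tmul_generator {𝔎 : S → S → B →L[ℂ] C} (h𝔎 : IsCPDKernel 𝔎) (x x' : E) (σ σ' : S)
    (b b' : B) (u u' : Unitization ℂ C) :
    letI := completionCorrespondence (representation h𝔎) (inner_representation h𝔎)
    inner C (InteriorTensor.tmul B C x (toCompletion C _ (generator h𝔎 σ b u)))
        (InteriorTensor.tmul B C x' (toCompletion C _ (generator h𝔎 σ' b' u')))
      = Unitization.sandwich (star u) (𝔎 σ σ' (star b * (inner B x x' * b'))) u' := by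
  let := completionCorrespondence (representation h𝔎) (inner_representation h𝔎)
  refine (InteriorTensor.inner_tmul B C x x' _ _).trans ?_
  have h := leftAction_toCompletion (representation h𝔎) (inner_representation h𝔎)
    (inner B x x' : B) (generator h𝔎 σ' b' u')
  refine (congrArg _ h).trans ?_
  rw [inner_toCompletion, representation_generator, inner_generator]

/-- A kernel family factors through an isometry of the interior tensor product with the
correspondence generated by the kernel. -/
theorem IsKernelFamily.exists_isometry {𝔎 : S → S → B →L[ℂ] C} (h𝔎 : IsCPDKernel 𝔎)
    {K : S → E → F} (hK : IsKernelFamily 𝔎 K) :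
    letI := completionCorrespondence (representation h𝔎) (inner_representation h𝔎)
    ∃ ν : InteriorTensor B C E (Completion C (KernelModule h𝔎)) →ₗ[ℂ] F,
      IsHilbertModuleIsometry C ν ∧ ∀ (x : E) (σ : S),
        ν (InteriorTensor.tmul B C x (toCompletion C _ (generator h𝔎 σ 1 1))) = K σ x := by
  let := completionCorrespondence (representation h𝔎) (inner_representation h𝔎)
  have hd := dense_span_tmul (B := B) (C := C) E _ (dense_span_generator h𝔎)
  -- The image of `x ⊙ (b ⊗ u)` over `σ` is `K^σ(x b) u`: in the interior tensor product `b` moves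
  -- across to `x`, and `u` acts from the right.
  obtain ⟨ν, hν, h⟩ := exists_isometry_of_total (C := C) _
    (fun p : E × S × B × Unitization ℂ C =>
      (unitizationSMul (K p.2.1 (op p.2.2.1 • p.1)) p.2.2.2 : F)) hd fun p q => by
      refine Eq.trans ?_ (inner_tmul_generator h𝔎 p.1 q.1 p.2.1 q.2.1 p.2.2.1 q.2.2.1 _ _).symm
      rw [inner_unitizationSMul, hK, inner_op_smul_left, inner_op_smul_right]
  refine ⟨ν, hν, fun x σ => (h (x, σ, 1, 1)).trans ?_⟩
  rw [op_one_smul, unitizationSMul_one]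

end families

theorem mainTheorem1
    {B : Type uB} [CStarAlgebra B] [PartialOrder B] [StarOrderedRing B]
    {C : Type uC} [NonUnitalCStarAlgebra C] [PartialOrder C] [StarOrderedRing C]
    {E : Type uE} [NormedAddCommGroup E] [NormedSpace ℂ E] [HilbertModule B E]
    {F : Type uF} [NormedAddCommGroup F] [NormedSpace ℂ F] [HilbertModule C F]
    {S : Type uS} (K : S → E → F) :
    (∃ 𝔎 : S → S → B →L[ℂ] C, IsCPDKernel 𝔎 ∧ IsKernelFamily 𝔎 K) ↔
      ∃ (𝓕 : Type (max uB uC uS w)) (_ : NormedAddCommGroup 𝓕) (_ : NormedSpace ℂ 𝓕)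
        (_ : HilbertModule C 𝓕) (_ : CStarCorrespondence B C 𝓕)
        (𝔦 : S → 𝓕) (ν : InteriorTensor B C E 𝓕 →ₗ[ℂ] F),
        IsHilbertModuleIsometry C ν ∧
          ∀ (x : E) (σ : S), ν (InteriorTensor.tmul B C x (𝔦 σ)) = K σ x := by
  constructor
  · rintro ⟨𝔎, h𝔎, hK⟩
    -- Lifting the index set places the constructed module in the prescribed universe, which
    -- includes `w`.
    let 𝔏 : ULift.{w} S → ULift.{w} S → B →L[ℂ] C := fun σ σ' => 𝔎 σ.down σ'.down
    have h𝔏 : IsCPDKernel 𝔏 := fun n σ => h𝔎 n fun i => (σ i).down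
    have hL : IsKernelFamily 𝔏 fun σ => K σ.down := fun σ σ' => hK σ.down σ'.down
    obtain ⟨ν, hν, h⟩ := hL.exists_isometry h𝔏
    exact ⟨SemiInnerProductModule.Completion C (KernelModule h𝔏), inferInstance, inferInstance,
      inferInstance, SemiInnerProductModule.completionCorrespondence
        (KernelModule.representation h𝔏) (KernelModule.inner_representation h𝔏),
      fun σ => SemiInnerProductModule.toCompletion C _ (KernelModule.generator h𝔏 ⟨σ⟩ 1 1),
      ν, hν, fun x σ => h x ⟨σ⟩⟩
  · rintro ⟨𝓕, _, _, _, _, 𝔦, ν, hν, h⟩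
    exact ⟨fun σ σ' => CStarCorrespondence.coefficient B C (𝔦 σ) (𝔦 σ'),
      CStarCorrespondence.isCPDKernel_coefficient 𝔦, isKernelFamily_coefficient hν h⟩
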